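/- Let $\mathbb{C}$ be a regular category, i.e. a category with finite limits in which every morphism factors as a regular epimorphism followed by a monomorphism, and in which regular epimorphisms are stable under pullback. A relation from $X$ to $Y$ is a subobject $\langle r_1,r_2\rangle\colon R\rightarrowtail X\times Y$, and a relation on $X$ is a relation from $X$ to $X$; $R^{\circ}$ denotes the opposite relation, given by $\langle r_2,r_1\rangle\colon R\rightarrowtail Y\times X$. For relations $R$ from $X$ to $Y$ and $S$ from $Y$ to $Z$, the composite $SR$ is the image of $\langle r_1\pi_1,s_2\pi_2\rangle\colon R\times_Y S\to X\times Z$, where $R\times_Y S$ is the pullback of $r_2$ and $s_1$, with projections $\pi_1,\pi_2$. A relation $R$ on $X$ is reflexive if $1_X\leqslant R$, where $1_X$ is the relation $\langle 1_X,1_X\rangle\colon X\rightarrowtail X\times X$; symmetric if $R^{\circ}\leqslant R$; transitive if $RR\leqslant R$; an equivalence relation if it is reflexive, symmetric and transitive; and positive if $R=U^{\circ}U$ for some relation $U$ from $X$ to some object $Y$. For morphisms $x\colon A\to X$ and $y\colon A\to Y$ (generalised elements), $(x,y)\in R$ means that $\langle x,y\rangle\colon A\to X\times Y$ factors through $R\rightarrowtail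 X\times Y$. **Theorem.** The following conditions on the regular category $\mathbb{C}$ are equivalent: (i) $\mathbb{C}$ is a Goursat category, i.e. $RSR=SRS$ for all equivalence relations $R$ and $S$ on the same object of $\mathbb{C}$; (ii) the Shifting Lemma holds in $\mathbb{C}$ when $S$ is a reflexive relation and $R$ and $T$ are reflexive and positive relations; that is, for every object $X$, every reflexive relation $S$ on $X$ and all reflexive and positive relations $R$ and $T$ on $X$ with $R\wedge S\leqslant T$, and for all generalised elements $x,y,u,v\colon A\to X$ with common domain, $$(x,y)\in R\wedge T,\quad (x,u)\in S,\quad (y,v)\in S,\quad (u,v)\in R\quad\Longrightarrow\quad (u,v)\in T.$$ -/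

import Mathlib

open CategoryTheory CategoryTheory.Limits

universe v u

noncomputable section

namespace Goursat

variable {C : Type u} [Category.{v} C] [Regular C]

/-- An internal relation from `X` to `Y`: a subobject of `X ⨯ Y`. -/
abbrev InternalRel (X Y : C) := Subobject (X ⨯ Y)

namespace InternalRel

/-- The first leg `r₁ : R ⟶ X` of a relation `R` from `X` to `Y`. -/
abbrev leg₁ {X Y : C} (R : InternalRel X Y) : (R : C) ⟶ X := R.arrow ≫ prod.fst

/-- The second leg `r₂ : R ⟶ Y` of a relation `R` from `X` to `Y`. -/
abbrev leg₂ {X Y : C} (R : InternalRel X Y) : (R : C) ⟶ Y := R.arrow ≫ prod.snd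

instance mono_lift_leg₂_leg₁ {X Y : C} (R : InternalRel X Y) :
    Mono (prod.lift R.leg₂ R.leg₁) where
  right_cancellation g h w := by
    have w₁ := w =≫ prod.fst
    have w₂ := w =≫ prod.snd
    simp only [Category.assoc, prod.lift_fst, prod.lift_snd] at w₁ w₂
    rw [← cancel_mono R.arrow]
    apply Limits.prod.hom_ext <;> simpa using by assumption

instance mono_diag (X : C) : Mono (prod.lift (𝟙 X) (𝟙 X)) where
  right_cancellation g h w := by
    have w₁ := w =≫ prod.fst
    simpa only [Category.assoc, prod.lift_fst, Category.comp_id] using w₁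

/-- The identity relation `1_X`, given by `⟨1_X, 1_X⟩ : X ⟶ X ⨯ X`. -/
def identity (X : C) : InternalRel X X := Subobject.mk (prod.lift (𝟙 X) (𝟙 X))

/-- The opposite relation `R°` from `Y` to `X`, given by `⟨r₂, r₁⟩ : R ⟶ Y ⨯ X`. -/
def opposite {X Y : C} (R : InternalRel X Y) : InternalRel Y X :=
  Subobject.mk (prod.lift R.leg₂ R.leg₁)

/-- The relational composite `SR` (first `R`, then `S`): the image, in `X ⨯ Z`, of the morphism
`⟨r₁ π₁, s₂ π₂⟩` defined on the pullback of `r₂` and `s₁`. In a regular category, the image of a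
morphism is the monomorphic part of its (regular epimorphism, monomorphism) factorization. -/
def comp {X Y Z : C} (S : InternalRel Y Z) (R : InternalRel X Y) : InternalRel X Z :=
  imageSubobject
    (prod.lift (pullback.fst R.leg₂ S.leg₁ ≫ R.leg₁) (pullback.snd R.leg₂ S.leg₁ ≫ S.leg₂))

def IsReflexive {X : C} (R : InternalRel X X) : Prop := identity X ≤ R

def IsSymmetric {X : C} (R : InternalRel X X) : Prop := R.opposite ≤ R

def IsTransitive {X : C} (R : InternalRel X X) : Prop := R.comp R ≤ R

structure IsEquivalence {X : C} (R : InternalRel X X) : Prop where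
  refl : R.IsReflexive
  symm : R.IsSymmetric
  trans : R.IsTransitive

/-- `P` is positive when `P = U°U` for some relation `U` from `X` to some object `Y`. -/
def IsPositive {X : C} (P : InternalRel X X) : Prop :=
  ∃ (Y : C) (U : InternalRel X Y), P = U.opposite.comp U

/-- `(x, y) ∈ R` for generalised elements `x` of `X` and `y` of `Y` with common domain `A`:
the morphism `⟨x, y⟩ : A ⟶ X ⨯ Y` factors through the subobject `R`. -/
def Mem {X Y A : C} (R : InternalRel X Y) (x : A ⟶ X) (y : A ⟶ Y) : Prop :=
  R.Factors (prod.lift x y)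

end InternalRel

/-- The property of the diagram of the Shifting Lemma for three given relations `R`, `S`, `T` on
the same object `X`: if `R ∧ S ≤ T`, then for all generalised elements `x, y, u, v` of `X` with
`(x, y) ∈ R ∧ T`, `(x, u) ∈ S`, `(y, v) ∈ S` and `(u, v) ∈ R`, one has `(u, v) ∈ T`. -/
def ShiftingLemma {X : C} (R S T : InternalRel X X) : Prop :=
  R ⊓ S ≤ T → ∀ (A : C) (x y u v : A ⟶ X),
    InternalRel.Mem (R ⊓ T) x y → S.Mem x u → S.Mem y v → R.Mem u v → T.Mem u v

variable (C) in
/-- A regular category is a Goursat category when it is `3`-permutable: `RSR = SRS` for all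
equivalence relations `R` and `S` on the same object. -/
def IsGoursat : Prop :=
  ∀ (X : C) (R S : InternalRel X X), R.IsEquivalence → S.IsEquivalence →
    R.comp (S.comp R) = S.comp (R.comp S)

end Goursat

end

open CategoryTheory CategoryTheory.Limits

namespace Goursat

variable {C : Type u} [Category.{v} C] [Regular C]

/-! ### Calculus of relations through generalised elements. -/

namespace InternalRel

variable {X Y Z A B : C}

/-! Composites are computed with generalised elements, up to regular epimorphic covers
(`exists_of_mem_comp`, `Mem.descend`). In a Goursat category, 3-permutability of the kernel pairs of
the legs of a span `D` gives `D°DD°D ≤ D°D` (`IsGoursat.exists_of_span`). For `P = U°U` this is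
transitivity, so reflexive positive relations are equivalences. Applied to a span built from chains
in `R ∧ T`, `S` and `R`, it gives the Shifting Lemma with `S` merely reflexive. Conversely, `RSR =
(SR)°(SR)` and `SRS` are positive, so the Shifting Lemma applies to them and yields `RSR ≤ SRS`;
exchanging `R` and `S` gives equality. -/

theorem mem_iff {R : InternalRel X Y} {x : A ⟶ X} {y : A ⟶ Y} :
    R.Mem x y ↔ ∃ r : A ⟶ (R : C), r ≫ R.leg₁ = x ∧ r ≫ R.leg₂ = y := by
  constructor
  · intro h
    have h' : R.Factors (prod.lift x y) := h
    refine ⟨R.factorThru _ h', ?_, ?_⟩ <;> rw [← Category.assoc, Subobject.factorThru_arrow]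
    · exact prod.lift_fst _ _
    · exact prod.lift_snd _ _
  · rintro ⟨r, rfl, rfl⟩
    have : prod.lift (r ≫ R.leg₁) (r ≫ R.leg₂) = r ≫ R.arrow := by
      apply Limits.prod.hom_ext <;> simp [prod.lift_fst, prod.lift_snd]
    rw [Mem, this]
    exact Subobject.factors_comp_arrow r

theorem mem_legs (R : InternalRel X Y) (r : A ⟶ (R : C)) : R.Mem (r ≫ R.leg₁) (r ≫ R.leg₂) :=
  mem_iff.2 ⟨r, rfl, rfl⟩

theorem Mem.precomp {R : InternalRel X Y} {x : A ⟶ X} {y : A ⟶ Y} (h : R.Mem x y) (p : B ⟶ A) :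
    R.Mem (p ≫ x) (p ≫ y) := by
  rw [Mem, ← prod.comp_lift]
  exact Subobject.factors_of_factors_right p h

theorem Mem.of_le {R S : InternalRel X Y} (hRS : R ≤ S) {x : A ⟶ X} {y : A ⟶ Y}
    (h : R.Mem x y) : S.Mem x y :=
  Subobject.factors_of_le _ hRS h

theorem le_of_mem {R S : InternalRel X Y}
    (h : ∀ {A : C} (x : A ⟶ X) (y : A ⟶ Y), R.Mem x y → S.Mem x y) : R ≤ S := by
  apply Subobject.le_of_factors
  have : R.arrow = prod.lift R.leg₁ R.leg₂ := by
    apply Limits.prod.hom_ext <;> simp [prod.lift_fst, prod.lift_snd]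
  rw [this]
  exact h _ _ (mem_iff.2 ⟨𝟙 _, by simp, by simp⟩)

theorem mem_inf {R S : InternalRel X Y} {x : A ⟶ X} {y : A ⟶ Y} :
    (R ⊓ S).Mem x y ↔ R.Mem x y ∧ S.Mem x y :=
  Subobject.inf_factors _

/-- Membership in a relation is local for regular epimorphisms. -/
theorem Mem.descend {R : InternalRel X Y} (p : B ⟶ A) [IsRegularEpi p] {x : A ⟶ X} {y : A ⟶ Y}
    (h : R.Mem (p ≫ x) (p ≫ y)) : R.Mem x y := by
  rw [Mem, ← prod.comp_lift] at h
  -- A regular epimorphism is strong, so it lifts against the mono `R.arrow`.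
  have sq : CommSq (R.factorThru _ h) p R.arrow (prod.lift x y) := ⟨by simp⟩
  have : sq.lift ≫ R.arrow = prod.lift x y := sq.fac_right
  rw [Mem, ← this]
  exact Subobject.factors_comp_arrow _

instance isRegularEpi_factorThruImageSubobject (f : X ⟶ Y) :
    IsRegularEpi (factorThruImageSubobject f) := by
  have : StrongEpi (factorThruImageSubobject f) := by
    unfold factorThruImageSubobject
    exact strongEpi_comp _ _
  infer_instance

/-- An element of a composite is witnessed by an intermediate element after passing to a regular
epimorphic cover. -/
theorem exists_of_mem_comp {S : InternalRel Y Z} {R : InternalRel X Y} {x : A ⟶ X} {z : A ⟶ Z}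
    (h : (S.comp R).Mem x z) : ∃ (B : C) (p : B ⟶ A) (_ : IsRegularEpi p) (y : B ⟶ Y),
      R.Mem (p ≫ x) y ∧ S.Mem y (p ≫ z) := by
  let f := prod.lift (pullback.fst R.leg₂ S.leg₁ ≫ R.leg₁) (pullback.snd R.leg₂ S.leg₁ ≫ S.leg₂)
  have h' : (imageSubobject f).Factors (prod.lift x z) := h
  let t := (imageSubobject f).factorThru _ h'
  -- The cover is the regular epimorphism onto the image, pulled back along `t`.
  have key : pullback.snd (factorThruImageSubobject f) t ≫ prod.lift x z =
      pullback.fst (factorThruImageSubobject f) t ≫ f := by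
    rw [← (imageSubobject f).factorThru_arrow _ h', ← Category.assoc, ← pullback.condition,
      Category.assoc, imageSubobject_arrow_comp]
  have k₁ := key =≫ prod.fst
  have k₂ := key =≫ prod.snd
  simp only [f, Category.assoc, prod.lift_fst, prod.lift_snd] at k₁ k₂
  refine ⟨_, pullback.snd (factorThruImageSubobject f) t, inferInstance,
    pullback.fst (factorThruImageSubobject f) t ≫ pullback.fst R.leg₂ S.leg₁ ≫ R.leg₂, ?_, ?_⟩
  · rw [k₁]
    exact mem_iff.2 ⟨pullback.fst _ t ≫ pullback.fst R.leg₂ S.leg₁, by simp [f], by simp [f]⟩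
  · rw [k₂, pullback.condition]
    exact mem_iff.2 ⟨pullback.fst _ t ≫ pullback.snd R.leg₂ S.leg₁, by simp [f], by simp [f]⟩

theorem Mem.comp {S : InternalRel Y Z} {R : InternalRel X Y} {x : A ⟶ X} {y : A ⟶ Y}
    {z : A ⟶ Z} (hR : R.Mem x y) (hS : S.Mem y z) : (S.comp R).Mem x z := by
  obtain ⟨r, rfl, hr⟩ := mem_iff.1 hR
  obtain ⟨s, hs, rfl⟩ := mem_iff.1 hS
  have e : prod.lift (r ≫ R.leg₁) (s ≫ S.leg₂) = pullback.lift r s (hr.trans hs.symm) ≫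
      prod.lift (pullback.fst R.leg₂ S.leg₁ ≫ R.leg₁) (pullback.snd R.leg₂ S.leg₁ ≫ S.leg₂) := by
    rw [prod.comp_lift, pullback.lift_fst_assoc, pullback.lift_snd_assoc]
  rw [Mem, e]
  exact imageSubobject_factors_comp_self _ _

theorem mem_opposite {R : InternalRel X Y} {x : A ⟶ X} {y : A ⟶ Y} :
    R.opposite.Mem y x ↔ R.Mem x y := by
  rw [Mem, opposite, Subobject.mk_factors_iff, mem_iff]
  constructor
  · rintro ⟨(r : A ⟶ (R : C)), (hr : r ≫ prod.lift R.leg₂ R.leg₁ = prod.lift y x)⟩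
    have h₁ := hr =≫ prod.fst
    have h₂ := hr =≫ prod.snd
    simp only [Category.assoc, prod.lift_fst, prod.lift_snd] at h₁ h₂
    exact ⟨r, h₂, h₁⟩
  · rintro ⟨r, rfl, rfl⟩
    exact ⟨r, prod.comp_lift _ _ _⟩

theorem isReflexive_iff {R : InternalRel X X} :
    R.IsReflexive ↔ ∀ {A : C} (x : A ⟶ X), R.Mem x x := by
  constructor
  · intro h A x
    refine Mem.of_le h ?_
    rw [Mem, identity, Subobject.mk_factors_iff]
    exact ⟨x, by simp [prod.comp_lift]⟩
  · intro h
    refine le_of_mem fun {A} x y hxy => ?_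
    rw [Mem, identity, Subobject.mk_factors_iff] at hxy
    obtain ⟨(r : A ⟶ X), (hr : r ≫ prod.lift (𝟙 X) (𝟙 X) = prod.lift x y)⟩ := hxy
    have h₁ := hr =≫ prod.fst
    have h₂ := hr =≫ prod.snd
    simp only [Category.assoc, prod.lift_fst, prod.lift_snd,
      Category.comp_id] at h₁ h₂
    obtain rfl : x = y := h₁.symm.trans h₂
    exact h x

theorem isSymmetric_iff {R : InternalRel X X} :
    R.IsSymmetric ↔ ∀ {A : C} {x y : A ⟶ X}, R.Mem x y → R.Mem y x :=
  ⟨fun h _ _ _ hxy => Mem.of_le h (mem_opposite.2 hxy),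
    fun h => le_of_mem fun _ _ hxy => h (mem_opposite.1 hxy)⟩

theorem isTransitive_iff {R : InternalRel X X} :
    R.IsTransitive ↔ ∀ {A : C} {x y z : A ⟶ X}, R.Mem x y → R.Mem y z → R.Mem x z := by
  refine ⟨fun h _ _ _ _ hxy hyz => Mem.of_le h (hxy.comp hyz), fun h => le_of_mem ?_⟩
  intro A x z hxz
  obtain ⟨B, p, _, y, hxy, hyz⟩ := exists_of_mem_comp hxz
  exact Mem.descend p (h hxy hyz)

theorem opposite_comp (S : InternalRel Y Z) (R : InternalRel X Y) :
    (S.comp R).opposite = R.opposite.comp S.opposite := by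
  apply le_antisymm
  · refine le_of_mem fun z x h => ?_
    obtain ⟨B, p, _, y, hxy, hyz⟩ := exists_of_mem_comp (mem_opposite.1 h)
    exact Mem.descend p ((mem_opposite.2 hyz).comp (mem_opposite.2 hxy))
  · refine le_of_mem fun z x h => ?_
    obtain ⟨B, p, _, y, hzy, hyx⟩ := exists_of_mem_comp h
    exact Mem.descend p (mem_opposite.2 ((mem_opposite.1 hyx).comp (mem_opposite.1 hzy)))

theorem comp_assoc {W : C} (T : InternalRel Z W) (S : InternalRel Y Z) (R : InternalRel X Y) :
    (T.comp S).comp R = T.comp (S.comp R) := by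
  apply le_antisymm
  · refine le_of_mem fun x w h => ?_
    obtain ⟨B, p, _, y, hxy, hyw⟩ := exists_of_mem_comp h
    obtain ⟨B', q, _, z, hyz, hzw⟩ := exists_of_mem_comp hyw
    exact Mem.descend p (Mem.descend q (((hxy.precomp q).comp hyz).comp hzw))
  · refine le_of_mem fun x w h => ?_
    obtain ⟨B, p, _, z, hxz, hzw⟩ := exists_of_mem_comp h
    obtain ⟨B', q, _, y, hxy, hyz⟩ := exists_of_mem_comp hxz
    exact Mem.descend p (Mem.descend q (hxy.comp (hyz.comp (hzw.precomp q))))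

theorem IsEquivalence.opposite_eq {R : InternalRel X X} (h : R.IsEquivalence) :
    R.opposite = R :=
  le_antisymm h.symm (le_of_mem fun _ _ hxy => mem_opposite.2 (isSymmetric_iff.1 h.symm hxy))

theorem IsEquivalence.comp_self {R : InternalRel X X} (h : R.IsEquivalence) : R.comp R = R :=
  le_antisymm h.trans (le_of_mem fun _ y hxy => hxy.comp (isReflexive_iff.1 h.refl y))

theorem IsReflexive.comp {R S : InternalRel X X} (hS : S.IsReflexive) (hR : R.IsReflexive) :
    (S.comp R).IsReflexive :=
  isReflexive_iff.2 fun x => (isReflexive_iff.1 hR x).comp (isReflexive_iff.1 hS x)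

/-- Since `R° = R`, `S° = S` and `SS = S`, one has `(SR)°(SR) = RSSR = RSR`. -/
theorem IsEquivalence.isPositive_conj {R S : InternalRel X X} (hR : R.IsEquivalence)
    (hS : S.IsEquivalence) : (R.comp (S.comp R)).IsPositive := by
  refine ⟨X, S.comp R, ?_⟩
  rw [opposite_comp, hR.opposite_eq, hS.opposite_eq, comp_assoc, ← comp_assoc S S R, hS.comp_self]

/-- The kernel pair of a morphism, as a relation on its domain. -/
noncomputable def kernel (f : X ⟶ Y) : InternalRel X X :=
  equalizerSubobject ((prod.fst : X ⨯ X ⟶ X) ≫ f) (prod.snd ≫ f)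

theorem mem_kernel {f : X ⟶ Y} {x y : A ⟶ X} : (kernel f).Mem x y ↔ x ≫ f = y ≫ f := by
  rw [Mem, kernel, equalizerSubobject_factors_iff]
  simp [prod.lift_fst_assoc, prod.lift_snd_assoc]

theorem isEquivalence_kernel (f : X ⟶ Y) : (kernel f).IsEquivalence where
  refl := isReflexive_iff.2 fun _ => mem_kernel.2 rfl
  symm := isSymmetric_iff.2 fun h => mem_kernel.2 (mem_kernel.1 h).symm
  trans := isTransitive_iff.2 fun h h' => mem_kernel.2 ((mem_kernel.1 h).trans (mem_kernel.1 h'))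

end InternalRel

/-! ### The two implications. -/

open InternalRel

/-- In a Goursat category the relation `D` tabulated by a span satisfies `D°DD°D ≤ D°D`. -/
theorem IsGoursat.exists_of_span (hC : IsGoursat C) {E X Y A : C} (f : E ⟶ X) (g : E ⟶ Y)
    {a b c d : A ⟶ E} (hab : a ≫ g = b ≫ g) (hbc : b ≫ f = c ≫ f) (hcd : c ≫ g = d ≫ g) :
    ∃ (B : C) (p : B ⟶ A) (_ : IsRegularEpi p) (m n : B ⟶ E),
      m ≫ f = p ≫ a ≫ f ∧ m ≫ g = n ≫ g ∧ n ≫ f = p ≫ d ≫ f := by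
  have h : ((kernel g).comp ((kernel f).comp (kernel g))).Mem a d :=
    ((mem_kernel.2 hab).comp (mem_kernel.2 hbc)).comp (mem_kernel.2 hcd)
  -- The chain `a ~g b ~f c ~g d` becomes `a ~f m ~g n ~f d` on a cover.
  rw [← hC E _ _ (isEquivalence_kernel f) (isEquivalence_kernel g)] at h
  obtain ⟨B, p, _, n, han, hnd⟩ := exists_of_mem_comp h
  obtain ⟨B', q, _, m, ham, hmn⟩ := exists_of_mem_comp han
  rw [mem_kernel] at hnd ham hmn
  have : IsRegularEpi (q ≫ p) := by
    have := strongEpi_comp q p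
    infer_instance
  refine ⟨B', q ≫ p, this, m, q ≫ n, ?_, hmn, ?_⟩
  · rw [← ham]; simp
  · rw [Category.assoc, hnd]; simp

/-- In a Goursat category, reflexive positive relations are equivalence relations. -/
theorem IsGoursat.isEquivalence_of_isPositive (hC : IsGoursat C) {X : C} {P : InternalRel X X}
    (hr : P.IsReflexive) (hp : P.IsPositive) : P.IsEquivalence := by
  obtain ⟨Y, U, rfl⟩ := hp
  refine ⟨hr, isSymmetric_iff.2 ?_, isTransitive_iff.2 ?_⟩
  · intro A x y h
    obtain ⟨B, p, _, w, hx, hy⟩ := exists_of_mem_comp h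
    exact Mem.descend p ((mem_opposite.1 hy).comp (mem_opposite.2 hx))
  · intro A x y z hxy hyz
    obtain ⟨B, p, _, w, hx, hy⟩ := exists_of_mem_comp hxy
    obtain ⟨B', q, _, w', hy', hz⟩ := exists_of_mem_comp (hyz.precomp p)
    rw [mem_opposite] at hy hz
    -- The zigzag in `U` consists of the pairs `(x, w)`, `(y, w)`, `(y, w')`, `(z, w')`.
    obtain ⟨a, ha, ha'⟩ := mem_iff.1 (hx.precomp q)
    obtain ⟨b, hb, hb'⟩ := mem_iff.1 (hy.precomp q)
    obtain ⟨c, hc, hc'⟩ := mem_iff.1 hy'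
    obtain ⟨d, hd, hd'⟩ := mem_iff.1 hz
    obtain ⟨D, t, _, m, n, hm, hmn, hn⟩ := hC.exists_of_span U.leg₁ U.leg₂
      (ha'.trans hb'.symm) (hb.trans hc.symm) (hc'.trans hd'.symm)
    refine Mem.descend p (Mem.descend q (Mem.descend t ?_))
    rw [← ha, ← hd, ← hm, ← hn]
    exact (U.mem_legs m).comp (mem_opposite.2 (hmn ▸ U.mem_legs n))

/-- In a Goursat category the Shifting Lemma holds for a reflexive relation `S` and equivalence
relations `R` and `T`. -/
theorem IsGoursat.shiftingLemma (hC : IsGoursat C) {X : C} {R S T : InternalRel X X}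
    (hS : S.IsReflexive) (hR : R.IsEquivalence) (hT : T.IsEquivalence) :
    ShiftingLemma R S T := by
  intro hRST A x y u v hxy hxu hyv huv
  have sr {A : C} (x : A ⟶ X) : S.Mem x x := isReflexive_iff.1 hS x
  have rr {A : C} (x : A ⟶ X) : R.Mem x x := isReflexive_iff.1 hR.refl x
  have rs {A : C} {x y : A ⟶ X} : R.Mem x y → R.Mem y x := isSymmetric_iff.1 hR.symm
  have rt {A : C} {x y z : A ⟶ X} : R.Mem x y → R.Mem y z → R.Mem x z := isTransitive_iff.1 hR.trans
  have tr {A : C} (x : A ⟶ X) : T.Mem x x := isReflexive_iff.1 hT.refl x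
  have ts {A : C} {x y : A ⟶ X} : T.Mem x y → T.Mem y x := isSymmetric_iff.1 hT.symm
  have tt {A : C} {x y z : A ⟶ X} : T.Mem x y → T.Mem y z → T.Mem x z := isTransitive_iff.1 hT.trans
  -- `E` consists of the chains `p (R ∧ T) q S w R t`, seen as a span from `(p, t)` to `w`.
  let E := pullback (pullback.snd (R ⊓ T).leg₂ S.leg₁ ≫ S.leg₂) R.leg₁
  let πS : E ⟶ (S : C) := pullback.fst _ _ ≫ pullback.snd _ _
  let πT : E ⟶ ((R ⊓ T : InternalRel X X) : C) := pullback.fst _ _ ≫ pullback.fst _ _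
  let πR : E ⟶ (R : C) := pullback.snd _ _
  have hTS : πT ≫ (R ⊓ T).leg₂ = πS ≫ S.leg₁ := by
    simp only [πT, πS, Category.assoc, pullback.condition]
  have hSR : πS ≫ S.leg₂ = πR ≫ R.leg₁ := by
    simp only [πR, πS, Category.assoc, pullback.condition]
  let f : E ⟶ X ⨯ X := prod.lift (πT ≫ (R ⊓ T).leg₁) (πR ≫ R.leg₂)
  let g : E ⟶ X := πS ≫ S.leg₂
  have mk {p q w t : A ⟶ X} (h₁ : (R ⊓ T).Mem p q) (h₂ : S.Mem q w) (h₃ : R.Mem w t) :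
      ∃ e : A ⟶ E, e ≫ f = prod.lift p t ∧ e ≫ g = w := by
    obtain ⟨e₁, rfl, he₁⟩ := mem_iff.1 h₁
    obtain ⟨e₂, he₂, rfl⟩ := mem_iff.1 h₂
    obtain ⟨e₃, he₃, rfl⟩ := mem_iff.1 h₃
    refine ⟨pullback.lift (pullback.lift e₁ e₂ (he₁.trans he₂.symm)) e₃ 
      (by rw [pullback.lift_snd_assoc, he₃]), ?_, ?_⟩
    · simp [f, πT, πR, prod.comp_lift, pullback.lift_fst_assoc, pullback.lift_snd_assoc]
    · simp [g, πS, pullback.lift_fst_assoc, pullback.lift_snd_assoc]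
  have unpack {B : C} (e : B ⟶ E) {p t : B ⟶ X} (he : e ≫ f = prod.lift p t) :
      ∃ q : B ⟶ X, (R ⊓ T).Mem p q ∧ S.Mem q (e ≫ g) ∧ R.Mem (e ≫ g) t := by
    have h₁ := he =≫ prod.fst
    have h₂ := he =≫ prod.snd
    simp only [f, Category.assoc, prod.lift_fst, prod.lift_snd] at h₁ h₂
    refine ⟨(e ≫ πS) ≫ S.leg₁, ?_, ?_, ?_⟩
    · rw [Category.assoc, ← hTS, ← h₁]
      exact mem_iff.2 ⟨e ≫ πT, Category.assoc _ _ _, Category.assoc _ _ _⟩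
    · rw [show e ≫ g = (e ≫ πS) ≫ S.leg₂ from (Category.assoc _ _ _).symm]
      exact mem_legs _ _
    · rw [show e ≫ g = (e ≫ πR) ≫ R.leg₁ by rw [Category.assoc, ← hSR], ← h₂]
      exact mem_iff.2 ⟨e ≫ πR, rfl, Category.assoc _ _ _⟩
  -- The zigzag in the span is `(u, u) – u – (x, u) – v – (v, u)`; the outcome is a common `w` for
  -- `(u, u)` and `(v, u)`.
  obtain ⟨a, haf, hag⟩ := mk (mem_inf.2 ⟨rr u, tr u⟩) (sr u) (rr u)
  obtain ⟨b, hbf, hbg⟩ := mk (mem_inf.2 ⟨rr x, tr x⟩) hxu (rr u)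
  obtain ⟨c, hcf, hcg⟩ := mk hxy hyv (rs huv)
  obtain ⟨d, hdf, hdg⟩ := mk (mem_inf.2 ⟨rr v, tr v⟩) (sr v) (rs huv)
  obtain ⟨B, p, _, m, n, hm, hmn, hn⟩ := hC.exists_of_span f g
    (hag.trans hbg.symm) (hbf.trans hcf.symm) (hcg.trans hdg.symm)
  rw [haf, prod.comp_lift p] at hm
  rw [hdf, prod.comp_lift p] at hn
  obtain ⟨q, hq, hqw, hwu⟩ := unpack m hm
  obtain ⟨q', hq', hqw', hwu'⟩ := unpack n hn
  rw [← hmn] at hqw' hwu'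
  rw [mem_inf] at hq hq'
  -- The second coordinate `u` gives `w R u`, so `q` and `w` are related by `R ∧ S ≤ T`; likewise
  -- `q'` and `w`, through `v R u`.
  have huw : T.Mem (p ≫ u) (m ≫ g) :=
    tt hq.2 (Mem.of_le hRST (mem_inf.2 ⟨rt (rs hq.1) (rs hwu), hqw⟩))
  have hvw : T.Mem (p ≫ v) (m ≫ g) :=
    tt hq'.2 (Mem.of_le hRST
      (mem_inf.2 ⟨rt (rs hq'.1) (rt (rs (huv.precomp p)) (rs hwu')), hqw'⟩))
  exact Mem.descend p (tt huw (ts hvw))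

/-- If the Shifting Lemma holds for reflexive relations `S` and reflexive positive relations `R`
and `T`, then `RSR ≤ SRS` for equivalence relations: shift along `R` from `RSR` to `SRS`. -/
theorem comp_le_of_shiftingLemma {X : C}
    (h : ∀ R S T : InternalRel X X, S.IsReflexive → R.IsReflexive → R.IsPositive →
      T.IsReflexive → T.IsPositive → ShiftingLemma R S T)
    {R S : InternalRel X X} (hR : R.IsEquivalence) (hS : S.IsEquivalence) :
    R.comp (S.comp R) ≤ S.comp (R.comp S) := by
  have rr {A : C} (x : A ⟶ X) : R.Mem x x := isReflexive_iff.1 hR.refl x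
  have sr {A : C} (x : A ⟶ X) : S.Mem x x := isReflexive_iff.1 hS.refl x
  refine le_of_mem fun x w hxw => ?_
  obtain ⟨B, p, _, z, hxz, hzw⟩ := exists_of_mem_comp hxw
  obtain ⟨B', q, _, y, hxy, hyz⟩ := exists_of_mem_comp hxz
  refine Mem.descend p (Mem.descend q ?_)
  -- The edge `(y, z)` lies in `S`, hence in both `RSR` and `SRS`; `R` itself plays the reflexive
  -- relation joining it to `(x, w)`.
  refine h (R.comp (S.comp R)) R (S.comp (R.comp S)) hR.refl
    (hR.refl.comp (hS.refl.comp hR.refl)) (hR.isPositive_conj hS)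
    (hS.refl.comp (hR.refl.comp hS.refl)) (hS.isPositive_conj hR) ?_ B' y (q ≫ z) _ _ ?_
    (isSymmetric_iff.1 hR.symm hxy) (hzw.precomp q) ((hxw.precomp p).precomp q)
  · exact le_of_mem fun a b hab => ((sr a).comp (mem_inf.1 hab).2).comp (sr b)
  · exact mem_inf.2 ⟨((rr y).comp hyz).comp (rr _), ((sr y).comp (rr y)).comp hyz⟩

end Goursat

theorem theorem3p5 (C : Type u) [CategoryTheory.Category.{v} C] [CategoryTheory.Regular C] :
    Goursat.IsGoursat C ↔
      ∀ (X : C) (R S T : Goursat.InternalRel X X),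
        S.IsReflexive →
        R.IsReflexive → R.IsPositive →
        T.IsReflexive → T.IsPositive →
        Goursat.ShiftingLemma R S T := by
  refine ⟨fun hC X R S T hS hR hR' hT hT' => hC.shiftingLemma hS
    (hC.isEquivalence_of_isPositive hR hR') (hC.isEquivalence_of_isPositive hT hT'), ?_⟩
  intro h X R S hR hS
  exact le_antisymm (Goursat.comp_le_of_shiftingLemma (h X) hR hS)
    (Goursat.comp_le_of_shiftingLemma (h X) hS hR)
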